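/- Let $0<\mathfrak n_1<\mathfrak n_2$ and let $\kappa\in\mathbb C$ with $\operatorname{Re}\kappa>0>\operatorname{Im}\kappa$. Put $\mathbb C_\pm=\{z\in\mathbb C:\pm\operatorname{Im}z>0\}$, $\mathcal E(y)(s)=\mathfrak n_1^2+(\mathfrak n_2^2-\mathfrak n_1^2)\,\chi_{\mathbb C_+}(y(s)^2)$, and let $\widehat{\mathbb C}=\mathbb C\cup\{\infty\}$. A tuple $(x,\varepsilon,\lambda_0,y)$ is called an *extended extremal tuple* if $y\in W^{2,\infty}_{\mathrm{loc}}(\mathbb R;\mathbb C)$ is a nontrivial solution of $-y''=\kappa^2\,y\,\mathcal E(y)$ a.e. on $\mathbb R$, $\varepsilon=\mathcal E(y)$, $x=y'/(i\kappa y):\mathbb R\to\widehat{\mathbb C}$ (with $x(s)=\infty$ where $y(s)=0$), and the quantity $\operatorname{Im}\big(\varepsilon(s)y(s)^2+\kappa^{-2}y'(s)^2\big)$, which does not depend on $s$, equals $\lambda_0\ge 0$. The tuple is *normal* if $\lambda_0>0$. A *switch point* of $\varepsilon$ is a point $b$ at which the one-sided limits $\varepsilon(b-0)$ and $\varepsilon(b+0)$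 exist and are different. Let $\gamma=\arg\kappa\in(-\pi/2,0)$, and for $\xi_1<\xi_2$ let $\mathrm{Sec}(\xi_1,\xi_2)=\{ce^{i\xi}:c>0,\ \xi\in(\xi_1,\xi_2)\}$. Put $\mathrm{Sec}_1=\{\operatorname{Re}z>0,\operatorname{Im}z>0\}$, $\mathrm{Sec}_3=\mathrm{Sec}(\pi/2-\gamma,\pi)$, $\mathrm{Sec}_4=\{\operatorname{Re}z<0,\operatorname{Im}z<0\}$, $\mathrm{Sec}_6=\mathrm{Sec}(3\pi/2-\gamma,2\pi)$. **Theorem.** Let $(x,\varepsilon,\lambda_0,y)$ be a normal extended extremal tuple, let $b_j<b_{j+1}$ be consecutive switch points of $\varepsilon$, and let $\epsilon=\varepsilon(b_j+0)$ be the value of $\varepsilon$ in the layer $I=(b_j,b_{j+1})$. Assume that $$x[I]\subset \mathrm{Sec}_6\cup\mathrm{Sec}_1\cup\mathrm{Sec}_3\cup\mathrm{Sec}_4\cup(\mathbb R\setminus\{0\}).$$ Then: (i) If $x(b_j)\in\mathbb C_+$, then $x(b_{j+1})\in\mathbb C_-$ and $b_{j+1}-b_j<\dfrac{\pi}{2\epsilon^{1/2}\operatorname{Re}\kappa}$.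 (ii) If $x(b_j)\in\mathbb C_-$, then $x(b_{j+1})\in\mathbb C_+$ and $\dfrac{\pi}{2\epsilon^{1/2}\operatorname{Re}\kappa}<b_{j+1}-b_j<\dfrac{\pi}{\epsilon^{1/2}\operatorname{Re}\kappa}$. -/

import Mathlib

open Filter Topology MeasureTheory

namespace LayeredExtremal

noncomputable section

/-- The infinite open sector of all `c * exp (i ξ)` with `c > 0` and `ξ₁ < ξ < ξ₂`. -/
def sector (ξ₁ ξ₂ : ℝ) : Set ℂ :=
  {z | ∃ c : ℝ, 0 < c ∧ ∃ ξ ∈ Set.Ioo ξ₁ ξ₂, z = (c : ℂ) * Complex.exp (Complex.I * (ξ : ℂ))}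

/-- `Sec₁` is the open first quadrant. -/
def Sec1 : Set ℂ := {z | 0 < z.re ∧ 0 < z.im}

/-- `Sec₃` is the sector between the line of turning points `i exp (-i Arg κ) ℝ` and the negative
real half-line. -/
def Sec3 (κ : ℂ) : Set ℂ := sector (Real.pi / 2 - Complex.arg κ) Real.pi

/-- `Sec₄` is the open third quadrant. -/
def Sec4 : Set ℂ := {z | z.re < 0 ∧ z.im < 0}

/-- `Sec₆` is the sector between the line of turning points `i exp (-i Arg κ) ℝ` and the positive
real half-line. -/
def Sec6 (κ : ℂ) : Set ℂ := sector (3 * Real.pi / 2 - Complex.arg κ) (2 * Real.pi)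

/-- The four sectors `Sec₁`, `Sec₃`, `Sec₄`, `Sec₆`, together with the open half-lines of the real
axis along which `Sec₆` borders on `Sec₁` and `Sec₃` borders on `Sec₄`. -/
def ordinaryRegion (κ : ℂ) : Set ℂ :=
  Sec6 κ ∪ Sec1 ∪ Sec3 κ ∪ Sec4 ∪ {z | z.im = 0 ∧ z.re ≠ 0}

/-- The open upper half-plane as a subset of the Riemann sphere. -/
def upperHalf : Set (OnePoint ℂ) := ((↑) : ℂ → OnePoint ℂ) '' {z | 0 < z.im}

/-- The open lower half-plane as a subset of the Riemann sphere. -/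
def lowerHalf : Set (OnePoint ℂ) := ((↑) : ℂ → OnePoint ℂ) '' {z | z.im < 0}

open Classical in
/-- The bang-bang feedback `n₁² + (n₂² - n₁²) χ_{ℂ₊}(y²)`. -/
def bangBang (n₁ n₂ : ℝ) (y : ℝ → ℂ) (s : ℝ) : ℝ :=
  n₁ ^ 2 + (n₂ ^ 2 - n₁ ^ 2) * (if 0 < (y s ^ 2).im then 1 else 0)

open Classical in
/-- The function `x = y' / (i κ y)` with values in the Riemann sphere, equal to `∞` at the zeros
of `y`. -/
def phaseState (κ : ℂ) (y : ℝ → ℂ) (s : ℝ) : OnePoint ℂ :=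
  if y s = 0 then OnePoint.infty else ((deriv y s / (Complex.I * κ * y s) : ℂ) : OnePoint ℂ)

/-- `(x, ε, lam, y)` is an extended extremal tuple: `y` is a nontrivial solution, of class
`W^{2,∞}_loc` on the whole real line (i.e. `C¹` with locally Lipschitz derivative), of the equation
`-y'' = κ² y 𝓔(y)`; moreover `ε = 𝓔(y)`, `x = y' / (i κ y)`, and the conserved quantity
`Im (ε y² + κ⁻² (y')²)` is equal to `lam ≥ 0`. -/
structure IsExtendedExtremal (κ : ℂ) (n₁ n₂ : ℝ)
    (x : ℝ → OnePoint ℂ) (ε : ℝ → ℝ) (lam : ℝ) (y : ℝ → ℂ) : Prop where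
  differentiable : Differentiable ℝ y
  locallyLipschitz_deriv : LocallyLipschitz (deriv y)
  nontrivial : ∃ s, y s ≠ 0
  equation : ∀ᵐ s ∂(volume : Measure ℝ),
    HasDerivAt (deriv y) (-(κ ^ 2 * y s * (bangBang n₁ n₂ y s : ℂ))) s
  control_eq : ∀ s, ε s = bangBang n₁ n₂ y s
  state_eq : ∀ s, x s = phaseState κ y s
  conserved : ∀ s, ((ε s : ℂ) * y s ^ 2 + (κ ^ 2)⁻¹ * deriv y s ^ 2).im = lam
  nonneg : 0 ≤ lam

/-- `b` is a switch point of `ε`: the one-sided limits `ε(b - 0)` and `ε(b + 0)` exist and are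
different. -/
def IsSwitchPoint (ε : ℝ → ℝ) (b : ℝ) : Prop :=
  ∃ l r : ℝ, Tendsto ε (𝓝[<] b) (𝓝 l) ∧ Tendsto ε (𝓝[>] b) (𝓝 r) ∧ l ≠ r

/-- `(b, b')` is a layer of permittivity `ϵ`: `b < b'` are consecutive switch points of `ε`, and
`ϵ = ε(b + 0)`. -/
structure IsLayer (ε : ℝ → ℝ) (b b' ϵ : ℝ) : Prop where
  lt : b < b'
  left_switch : IsSwitchPoint ε b
  right_switch : IsSwitchPoint ε b'
  no_switch : ∀ s ∈ Set.Ioo b b', ¬ IsSwitchPoint ε s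
  permittivity : Tendsto ε (𝓝[>] b) (𝓝 ϵ)

end

end LayeredExtremal

open Filter Topology MeasureTheory

namespace LayeredExtremal

/-! ### Locally Lipschitz functions and their almost everywhere derivatives -/

/-! Inside a layer the curve `y` makes a quarter turn around the origin, and the explicit solution
of the constant-coefficient equation tells how long it takes.

The quantity `W = Im (y' ȳ) = |y|² Re (κ x)` is strictly increasing. On the prescribed region `Re (κ
x)` and `Re x` are nonzero with the same sign (`mem_sector_re`), so `W` keeps one sign in the layer
and `y` turns in one direction. Since `(y²)' = 2 i κ x y²`, every real value of `y²` in the interior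
would be a transversal crossing, hence a switch. So `y²` is real only at the two ends, where `y ≠
0`, and its sign differs there (`quarter_turn`).

At both ends the conserved quantity reads `Im (x² y²) = -lam ≠ 0`. As `y²` changes sign and `Re x`
does not, `Im x` changes sign. For the duration, put `k = κ √ϵ` and `z₀ = x / √ϵ` at the start; then
`2 y / y(0) = exp(iks)(1 + z₀) + exp(-iks)(1 - z₀)` must have nonnegative real part throughout and
be positive imaginary at the end. Testing this at `π / (2 Re k)` and `π / Re k`, and comparing the
two ends, gives the bounds (`quarter_turn_duration`). This assumes `Re z₀ > 0`; the case `W < 0`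
reduces to it by time reversal. -/

lemma absolutelyContinuousOnInterval_of_locallyLipschitz {F : Type*} [NormedAddCommGroup F]
    {f : ℝ → F} (hf : LocallyLipschitz f) (a b : ℝ) : AbsolutelyContinuousOnInterval f a b := by
  obtain ⟨K, hK⟩ := (hf.locallyLipschitzOn (s := Set.uIcc a b)).exists_lipschitzOnWith_of_compact
    isCompact_uIcc
  exact hK.absolutelyContinuousOnInterval

/-- Local Lipschitz continuity gives absolute continuity, so the increment is the integral of the
a.e. derivative. -/
lemma monotone_of_ae_hasDerivAt_nonneg {f f' : ℝ → ℝ} (hf : LocallyLipschitz f)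
    (hf' : ∀ᵐ s, HasDerivAt f (f' s) s) (h0 : ∀ s, 0 ≤ f' s) : Monotone f := by
  intro s t hst
  have h := (absolutelyContinuousOnInterval_of_locallyLipschitz hf s t).integral_deriv_eq_sub
  have : 0 ≤ ∫ x in s..t, deriv f x := by
    apply intervalIntegral.integral_nonneg_of_ae hst
    filter_upwards [hf'] with x hx
    simpa [hx.deriv] using h0 x
  linarith

lemma locallyLipschitz_of_hasDerivAt {F : Type*} [NormedAddCommGroup F] [NormedSpace ℝ F]
    {f f' : ℝ → F} (h : ∀ s, HasDerivAt f (f' s) s) (hc : Continuous f') :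
    LocallyLipschitz f := by
  refine ContDiff.locallyLipschitz (𝕂 := ℝ) (contDiff_one_iff_deriv.2
    ⟨fun s => (h s).differentiableAt, ?_⟩)
  rwa [show deriv f = f' from funext fun s => (h s).deriv]

lemma eq_of_hasDerivAt_zero {F : Type*} [NormedAddCommGroup F] [NormedSpace ℝ F]
    [CompleteSpace F] {f : ℝ → F} {a b : ℝ} (hc : ContinuousOn f (Set.Icc a b))
    (h : ∀ s ∈ Set.Ioo a b, HasDerivAt f 0 s) {s : ℝ} (hs : s ∈ Set.Icc a b) : f s = f a := by
  have := intervalIntegral.integral_eq_sub_of_hasDerivAt_of_le (f' := fun _ => (0 : F)) hs.1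
    (hc.mono (Set.Icc_subset_Icc_right hs.2))
    (fun t ht => h t ⟨ht.1, ht.2.trans_le hs.2⟩) (by simp)
  simpa [sub_eq_zero, eq_comm] using this

/-! ### Solutions of the equation with constant coefficient -/

/-- The first-order factor `V + i k Y` satisfies `w' = i k w`. Using it with `k` and with `-k`
recovers the full solution. -/
lemma exp_mul_add_eq {Y V : ℝ → ℂ} {k : ℂ} {L : ℝ}
    (hY : ContinuousOn Y (Set.Icc 0 L)) (hV : ContinuousOn V (Set.Icc 0 L))
    (hY' : ∀ s ∈ Set.Ioo 0 L, HasDerivAt Y (V s) s)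
    (hV' : ∀ s ∈ Set.Ioo 0 L, HasDerivAt V (-(k ^ 2 * Y s)) s) {s : ℝ}
    (hs : s ∈ Set.Icc 0 L) :
    V s + Complex.I * k * Y s = Complex.exp (Complex.I * k * s) * (V 0 + Complex.I * k * Y 0) := by
  have he : ∀ s : ℝ, HasDerivAt (fun s : ℝ => Complex.exp (-(Complex.I * k * s)))
      (Complex.exp (-(Complex.I * k * s)) * (-(Complex.I * k))) s := by
    intro s
    have := (((hasDerivAt_id s).ofReal_comp.const_mul (Complex.I * k)).neg).cexp
    simpa using this
  have key := eq_of_hasDerivAt_zero (a := 0) (b := L)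
    (f := fun s : ℝ => Complex.exp (-(Complex.I * k * s)) * (V s + Complex.I * k * Y s))
    (by
      refine ContinuousOn.mul (fun s _ => (he s).continuousAt.continuousWithinAt) ?_
      exact hV.add (continuousOn_const.mul hY))
    (fun s hs => by
      refine ((he s).mul ((hV' s hs).add ((hY' s hs).const_mul (Complex.I * k)))).congr_deriv ?_
      simp only [Pi.add_apply]
      linear_combination (-Complex.exp (-(Complex.I * k * s)) * k ^ 2 * Y s) * Complex.I_sq) hs
  have h1 : Complex.exp (Complex.I * k * s) * Complex.exp (-(Complex.I * k * s)) = 1 := by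
    rw [← Complex.exp_add]; simp
  simp only [Complex.ofReal_zero, mul_zero, neg_zero, Complex.exp_zero, one_mul] at key
  rw [← key, ← mul_assoc, h1, one_mul]

/-! ### Quarter turns and their duration -/

/-- The quotient is the tangent of the argument of `u`, and its derivative is `Im (u' ū) / (Re u)²`.
-/
lemma strictMonoOn_im_div_re {u v : ℝ → ℂ} {t : ℝ}
    (hu : ContinuousOn u (Set.Icc 0 t)) (hu' : ∀ s ∈ Set.Ioo 0 t, HasDerivAt u (v s) s)
    (hW : ∀ s ∈ Set.Ioo 0 t, 0 < (v s * (starRingEnd ℂ) (u s)).im)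
    (hp : ∀ s ∈ Set.Icc 0 t, (u s).re ≠ 0) :
    StrictMonoOn (fun s => (u s).im / (u s).re) (Set.Icc 0 t) := by
  refine strictMonoOn_of_deriv_pos (convex_Icc 0 t)
    ((Complex.continuous_im.comp_continuousOn hu).div
      (Complex.continuous_re.comp_continuousOn hu) hp) fun s hs => ?_
  rw [interior_Icc] at hs
  have h0 := hp s ⟨hs.1.le, hs.2.le⟩
  have hre : HasDerivAt (fun s => (u s).re) (v s).re s :=
    (Complex.reCLM.hasFDerivAt.comp_hasDerivAt s (hu' s hs))
  have him : HasDerivAt (fun s => (u s).im) (v s).im s :=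
    (Complex.imCLM.hasFDerivAt.comp_hasDerivAt s (hu' s hs))
  rw [(him.fun_div hre h0).deriv]
  have hw := hW s hs
  simp only [Complex.mul_im, Complex.conj_re, Complex.conj_im] at hw
  apply div_pos _ (by positivity)
  linarith

/-- A curve that starts at `1`, turns counterclockwise, and meets the coordinate axes again at time
`L` only, arrives at the positive imaginary axis through the first quadrant. -/
lemma quarter_turn {u v : ℝ → ℂ} {L : ℝ} (hL : 0 < L)
    (hu : ContinuousOn u (Set.Icc 0 L)) (hu' : ∀ s ∈ Set.Ioo 0 L, HasDerivAt u (v s) s)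
    (hW : ∀ s ∈ Set.Ioc 0 L, 0 < (v s * (starRingEnd ℂ) (u s)).im)
    (h0 : u 0 = 1) (hI : ∀ s ∈ Set.Ioo 0 L, (u s ^ 2).im ≠ 0) (hend : (u L ^ 2).im = 0) :
    (∀ s ∈ Set.Icc 0 L, 0 ≤ (u s).re) ∧ ∃ η : ℝ, 0 < η ∧ u L = Complex.I * η := by
  have sq_im : ∀ z : ℂ, (z ^ 2).im = 2 * z.re * z.im := fun z => by
    rw [sq, Complex.mul_im]; ring
  have hpc : ContinuousOn (fun s => (u s).re) (Set.Icc 0 L) :=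
    Complex.continuous_re.comp_continuousOn hu
  have hqc : ContinuousOn (fun s => (u s).im) (Set.Icc 0 L) :=
    Complex.continuous_im.comp_continuousOn hu
  have hpne : ∀ s ∈ Set.Ioo 0 L, (u s).re ≠ 0 := fun s hs h => hI s hs (by rw [sq_im, h]; ring)
  have hqne : ∀ s ∈ Set.Ioo 0 L, (u s).im ≠ 0 := fun s hs h => hI s hs (by rw [sq_im, h]; ring)
  have hp : ∀ s ∈ Set.Icc 0 L, 0 ≤ (u s).re := by
    intro s hs
    by_contra! hneg
    obtain ⟨t, ht, ht0⟩ := intermediate_value_Ioo' hs.1 (hpc.mono (Set.Icc_subset_Icc_right hs.2))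
      (show (0 : ℝ) ∈ Set.Ioo (u s).re (u 0).re from ⟨hneg, by simp [h0]⟩)
    exact hpne t ⟨ht.1, ht.2.trans_le hs.2⟩ ht0
  have hq : ∀ s ∈ Set.Ioc 0 L, (u s).re ≠ 0 → 0 < (u s).im := by
    intro s hs hne
    have hm := strictMonoOn_im_div_re (t := s) (hu.mono (Set.Icc_subset_Icc_right hs.2))
      (fun t ht => hu' t ⟨ht.1, ht.2.trans_le hs.2⟩) (fun t ht => hW t ⟨ht.1, ht.2.le.trans hs.2⟩)
      (fun t ht => by
        rcases ht.1.eq_or_lt with rfl | h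
        · simp [h0]
        rcases ht.2.eq_or_lt with rfl | h'
        · exact hne
        exact hpne t ⟨h, h'.trans_le hs.2⟩)
    have := hm (Set.left_mem_Icc.2 hs.1.le) (Set.right_mem_Icc.2 hs.1.le) hs.1
    simp only [h0, Complex.one_im, Complex.one_re, zero_div] at this
    have hpos : 0 < (u s).re := (hp s ⟨hs.1.le, hs.2⟩).lt_of_ne hne.symm
    exact (div_pos_iff_of_pos_right hpos).1 this
  have hLmem : L ∈ Set.Ioc 0 L := ⟨hL, le_rfl⟩
  have hpL : (u L).re = 0 := by
    by_contra hne
    have := hq L hLmem hne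
    rw [sq_im] at hend
    simp [hne, this.ne'] at hend
  -- A negative value would force a zero of `Im u` in the interior; the value zero would make `u L =
  -- 0`, against `hW` at `L`.
  have hqL : 0 < (u L).im := by
    have hw := hW L hLmem
    have hmid : L / 2 ∈ Set.Ioo 0 L := ⟨by linarith, by linarith⟩
    have hqm := hq (L / 2) ⟨hmid.1, hmid.2.le⟩ (hpne _ hmid)
    rcases lt_trichotomy (u L).im 0 with h | h | h
    · obtain ⟨t, ht, ht0⟩ := intermediate_value_Ioo' hmid.2.le
        (hqc.mono (Set.Icc_subset_Icc_left hmid.1.le))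
        (show (0 : ℝ) ∈ Set.Ioo (u L).im (u (L / 2)).im from ⟨h, hqm⟩)
      exact absurd ht0 (hqne t ⟨hmid.1.trans ht.1, ht.2⟩)
    · simp [Complex.mul_im, hpL, h] at hw
    · exact h
  exact ⟨hp, (u L).im, hqL, by apply Complex.ext <;> simp [hpL]⟩

/-- Bounds for the duration of a quarter turn of a solution `Y` of `Y'' = -k² Y` in the regime where
`Re (Y' / (i k Y))` is positive at both ends. -/
lemma quarter_turn_duration {Y V : ℝ → ℂ} {k z₀ z₁ : ℂ} {L c : ℝ} (hk : 0 < k.re) (hk' : k.im < 0)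
    (hL : 0 < L) (hY : ContinuousOn Y (Set.Icc 0 L)) (hV : ContinuousOn V (Set.Icc 0 L))
    (hY' : ∀ s ∈ Set.Ioo 0 L, HasDerivAt Y (V s) s)
    (hV' : ∀ s ∈ Set.Ioo 0 L, HasDerivAt V (-(k ^ 2 * Y s)) s)
    (hW : ∀ s ∈ Set.Ioc 0 L, 0 < (V s * (starRingEnd ℂ) (Y s)).im)
    (h0 : Y 0 ≠ 0) (h0im : (Y 0 ^ 2).im = 0) (hI : ∀ s ∈ Set.Ioo 0 L, (Y s ^ 2).im ≠ 0)
    (hLim : (Y L ^ 2).im = 0) (hz₀ : V 0 = Complex.I * k * z₀ * Y 0)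
    (hz₁ : V L = Complex.I * k * z₁ * Y L) (hz₀re : 0 < z₀.re) (hz₁re : 0 < z₁.re)
    (hc : c ≠ 0) (hc₀ : (z₀ ^ 2 * Y 0 ^ 2).im = c) (hc₁ : (z₁ ^ 2 * Y L ^ 2).im = c) :
    z₀.im * z₁.im < 0 ∧ (0 < z₀.im → L < Real.pi / (2 * k.re)) ∧
      (z₀.im < 0 → Real.pi / (2 * k.re) < L ∧ L < Real.pi / k.re) := by
  -- Because `Y 0 ^ 2` is real, dividing by `Y 0` preserves the times at which the square is real.
  have hreal : ∃ r : ℝ, r ≠ 0 ∧ Y 0 ^ 2 = r := by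
    have h : Y 0 ^ 2 = ((Y 0 ^ 2).re : ℂ) := by apply Complex.ext <;> simp [h0im]
    refine ⟨(Y 0 ^ 2).re, fun hr => ?_, h⟩
    rw [hr] at h
    exact pow_ne_zero 2 h0 (by simpa using h)
  obtain ⟨r, hr, hYr⟩ := hreal
  have husq : ∀ s, ((Y s / Y 0) ^ 2).im = (Y s ^ 2).im / r := by
    intro s
    rw [div_pow, hYr, Complex.div_ofReal_im]
  have hns : 0 < Complex.normSq (Y 0) := Complex.normSq_pos.2 h0
  obtain ⟨hre, η, hη, huL⟩ := quarter_turn (u := fun s => Y s / Y 0) (v := fun s => V s / Y 0) hL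
    (hY.div_const _) (fun s hs => (hY' s hs).div_const _)
    (fun s hs => by
      have e : V s / Y 0 * (starRingEnd ℂ) (Y s / Y 0)
          = V s * (starRingEnd ℂ) (Y s) / (Complex.normSq (Y 0) : ℝ) := by
        rw [map_div₀, div_mul_div_comm, Complex.mul_conj]
      rw [e, Complex.div_ofReal_im]
      exact div_pos (hW s hs) hns)
    (div_self h0) (fun s hs => by
      rw [husq]; exact div_ne_zero (hI s hs) hr) (by rw [husq, hLim, zero_div])
  have hkne : Complex.I * k ≠ 0 := mul_ne_zero Complex.I_ne_zero (by rintro rfl; simp at hk)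
  have hplus : ∀ s ∈ Set.Icc 0 L, V s + Complex.I * k * Y s =
      Complex.exp (Complex.I * k * s) * (V 0 + Complex.I * k * Y 0) :=
    fun s hs => exp_mul_add_eq hY hV hY' hV' hs
  have hminus : ∀ s ∈ Set.Icc 0 L, V s + Complex.I * (-k) * Y s =
      Complex.exp (Complex.I * (-k) * s) * (V 0 + Complex.I * (-k) * Y 0) :=
    fun s hs => exp_mul_add_eq hY hV hY' (by simpa using hV') hs
  have hform : ∀ s ∈ Set.Icc 0 L, 2 * (Y s / Y 0) =
      Complex.exp (Complex.I * k * s) * (1 + z₀) + Complex.exp (Complex.I * (-k) * s) * (1 - z₀) := by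
    intro s hs
    have h1 := hplus s hs
    have h2 := hminus s hs
    rw [hz₀] at h1 h2
    rw [← mul_div_assoc, div_eq_iff h0]
    apply mul_left_cancel₀ hkne
    linear_combination h1 - h2
  have hLmem : L ∈ Set.Icc 0 L := ⟨hL.le, le_rfl⟩
  have hYL : Y L = Complex.I * η * Y 0 := by
    rw [← huL, div_mul_cancel₀ _ h0]
  have hlast : Complex.I * η * (1 + z₁) = Complex.exp (Complex.I * k * L) * (1 + z₀) := by
    have h1 := hplus L hLmem
    rw [hz₁, hz₀, hYL] at h1
    apply mul_left_cancel₀ (mul_ne_zero hkne h0)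
    linear_combination h1
  have hre_form : ∀ s ∈ Set.Icc 0 L, 0 ≤
      Real.exp (-k.im * s) * (Real.cos (k.re * s) * (1 + z₀.re) - Real.sin (k.re * s) * z₀.im) +
      Real.exp (k.im * s) * (Real.cos (k.re * s) * (1 - z₀.re) - Real.sin (k.re * s) * z₀.im) := by
    intro s hs
    have h := congrArg Complex.re (hform s hs)
    have h' := hre s hs
    simp only [Complex.mul_re, Complex.mul_im, Complex.add_re, Complex.add_im, Complex.exp_re,
      Complex.exp_im, Complex.I_re, Complex.I_im, Complex.ofReal_re, Complex.ofReal_im,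
      Complex.neg_re, Complex.neg_im, Complex.sub_re, Complex.sub_im, Complex.one_re,
      Complex.one_im, Complex.re_ofNat, Complex.im_ofNat, zero_mul, one_mul, mul_zero, zero_sub,
      sub_zero, zero_add, neg_neg, neg_mul, mul_neg, Real.cos_neg, Real.sin_neg] at h
    simp only [neg_mul]
    linarith
  -- `Y L ^ 2 = -η² r` and `Y 0 ^ 2 = r` have opposite signs, while `Im (z² Y²)` is the same nonzero
  -- `c` at both ends.
  have hprod : z₀.im * z₁.im < 0 := by
    have e : Y L ^ 2 = ((-(η ^ 2) * r : ℝ) : ℂ) := by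
      rw [hYL]; push_cast; rw [← hYr]
      linear_combination (η ^ 2 * Y 0 ^ 2 : ℂ) * Complex.I_sq
    rw [e, Complex.im_mul_ofReal, sq, Complex.mul_im] at hc₁
    rw [hYr, Complex.im_mul_ofReal, sq, Complex.mul_im] at hc₀
    have h : 0 < c * c := mul_self_pos.2 hc
    nth_rw 1 [← hc₀] at h
    rw [← hc₁] at h
    by_contra! hn
    have h5 : 0 ≤ 4 * (z₀.re * z₁.re) * (z₀.im * z₁.im) * (η ^ 2 * r ^ 2) := by positivity
    nlinarith
  have hE : ∀ t : ℝ, 0 < Real.exp t := Real.exp_pos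
  refine ⟨hprod, fun him => ?_, fun him => ⟨?_, ?_⟩⟩
  -- At `π / (2 Re k)` the cosine vanishes, and `2 Re u` is a negative multiple of `Im z₀`.
  · by_contra! hge
    have hs0 : 0 < Real.pi / (2 * k.re) := by have := Real.pi_pos; positivity
    have h := hre_form _ ⟨hs0.le, hge⟩
    have e : k.re * (Real.pi / (2 * k.re)) = Real.pi / 2 := by field_simp
    rw [e, Real.cos_pi_div_two, Real.sin_pi_div_two] at h
    nlinarith [mul_pos (hE (-k.im * (Real.pi / (2 * k.re)))) him,
      mul_pos (hE (k.im * (Real.pi / (2 * k.re)))) him]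
  · by_contra! hle
    have him₁ : 0 < z₁.im := by by_contra! hn; nlinarith
    have hcos : 0 ≤ Real.cos (k.re * L) := by
      apply Real.cos_nonneg_of_neg_pi_div_two_le_of_le
      · have := mul_pos hk hL
        linarith [Real.pi_pos]
      · rw [le_div_iff₀ (by positivity)] at hle
        linarith
    -- Multiplying by the conjugate of `1 + z₀` leaves a nonnegative multiple of `cos (Re k L)` on
    -- the right, while the left has real part `-η Im ((1 + z₁) conj (1 + z₀)) < 0`.
    have h := congrArg Complex.re (congrArg (· * (starRingEnd ℂ) (1 + z₀)) hlast)
    simp only [Complex.mul_re, Complex.mul_im, Complex.add_re, Complex.add_im, Complex.exp_re,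
      Complex.exp_im, Complex.I_re, Complex.I_im, Complex.ofReal_re, Complex.ofReal_im,
      Complex.one_re, Complex.one_im, Complex.conj_re, Complex.conj_im, zero_mul, one_mul, mul_zero,
      zero_sub, sub_zero, zero_add, neg_mul, mul_neg] at h
    have h6 : 0 ≤ Real.exp (-(k.im * L)) * Real.cos (k.re * L) *
        ((1 + z₀.re) ^ 2 + z₀.im ^ 2) := by positivity
    have h7 : 0 < η * (z₁.im * (1 + z₀.re) + (-z₀.im) * (1 + z₁.re)) := by
      have : 0 < -z₀.im := by linarith
      positivity
    nlinarith
  -- At `π / Re k`, with `a = -π Im k / Re k > 0`, twice the real part is `-2 (cosh a + Re z₀ sinh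
  -- a) < 0`.
  · by_contra! hge
    have hs0 : 0 < Real.pi / k.re := by have := Real.pi_pos; positivity
    have h := hre_form _ ⟨hs0.le, hge⟩
    have e : k.re * (Real.pi / k.re) = Real.pi := by field_simp
    rw [e, Real.cos_pi, Real.sin_pi] at h
    have hlt : Real.exp (k.im * (Real.pi / k.re)) < Real.exp (-k.im * (Real.pi / k.re)) := by
      apply Real.exp_lt_exp.2
      nlinarith
    nlinarith [mul_pos (sub_pos.2 hlt) hz₀re, hE (k.im * (Real.pi / k.re)),
      hE (-k.im * (Real.pi / k.re))]

/-! ### The sectors -/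

/-- The line of turning points is `Re (κ z) = 0`. The region omits the two sectors between it and
the imaginary axis, exactly where `Re z` and `Re (κ z)` disagree in sign. -/
lemma mem_sector_re {κ z : ℂ} (hκre : 0 < κ.re) (hκim : κ.im < 0)
    (hz : z ∈ ordinaryRegion κ) :
    (0 < z.re ∧ 0 < (κ * z).re) ∨ (z.re < 0 ∧ (κ * z).re < 0) := by
  have hκ0 : κ ≠ 0 := by rintro rfl; simp at hκre
  have hγneg : Complex.arg κ < 0 := Complex.arg_neg_iff.2 hκim
  have hγ : -(Real.pi / 2) < Complex.arg κ := by
    have := (Complex.abs_arg_lt_pi_div_two_iff (z := κ)).2 (Or.inl hκre)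
    exact (abs_lt.1 this).1
  have hpi := Real.pi_pos
  have hre : ∀ c ξ : ℝ, ((c : ℂ) * Complex.exp (Complex.I * (ξ : ℂ))).re = c * Real.cos ξ := by
    intro c ξ
    rw [Complex.re_ofReal_mul, mul_comm Complex.I, Complex.exp_ofReal_mul_I_re]
  have hκre' : ∀ c ξ : ℝ, (κ * ((c : ℂ) * Complex.exp (Complex.I * (ξ : ℂ)))).re =
      ‖κ‖ * c * Real.cos (Complex.arg κ + ξ) := by
    intro c ξ
    have : κ * ((c : ℂ) * Complex.exp (Complex.I * (ξ : ℂ))) =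
        ((‖κ‖ * c : ℝ) : ℂ) * Complex.exp (((Complex.arg κ + ξ : ℝ) : ℂ) * Complex.I) := by
      conv_lhs => rw [← Complex.norm_mul_exp_arg_mul_I κ]
      push_cast
      rw [add_mul, Complex.exp_add, mul_comm Complex.I]
      ring
    rw [this, Complex.re_ofReal_mul, Complex.exp_ofReal_mul_I_re]
  have hn : 0 < ‖κ‖ := norm_pos_iff.2 hκ0
  rcases hz with (((h | h) | h) | h) | h
  · obtain ⟨c, hc, ξ, ⟨h1, h2⟩, rfl⟩ := h
    left
    rw [hre, hκre', ← Real.cos_sub_two_pi, ← Real.cos_sub_two_pi (_ + ξ)]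
    exact ⟨mul_pos hc (Real.cos_pos_of_mem_Ioo ⟨by linarith, by linarith⟩),
      mul_pos (mul_pos hn hc) (Real.cos_pos_of_mem_Ioo ⟨by linarith, by linarith⟩)⟩
  · left
    rw [Complex.mul_re]
    exact ⟨h.1, by nlinarith [mul_pos hκre h.1, mul_pos (neg_pos.2 hκim) h.2]⟩
  · obtain ⟨c, hc, ξ, ⟨h1, h2⟩, rfl⟩ := h
    right
    rw [hre, hκre']
    exact ⟨mul_neg_of_pos_of_neg hc (Real.cos_neg_of_pi_div_two_lt_of_lt (by linarith)
        (by linarith)),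
      mul_neg_of_pos_of_neg (mul_pos hn hc) (Real.cos_neg_of_pi_div_two_lt_of_lt (by linarith)
        (by linarith))⟩
  · right
    rw [Complex.mul_re]
    have h1 := mul_pos hκre (neg_pos.2 h.1)
    have h2 := mul_pos (neg_pos.2 hκim) (neg_pos.2 h.2)
    exact ⟨h.1, by linarith⟩
  · obtain ⟨h1, h2⟩ := h
    rw [Complex.mul_re, h1, mul_zero, sub_zero]
    rcases h2.lt_or_gt with h2 | h2
    · exact Or.inr ⟨h2, mul_neg_of_pos_of_neg hκre h2⟩
    · exact Or.inl ⟨h2, mul_pos hκre h2⟩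

/-! ### The feedback and its switch points -/

lemma bangBang_of_pos {n₁ n₂ : ℝ} {y : ℝ → ℂ} {s : ℝ} (h : 0 < (y s ^ 2).im) :
    bangBang n₁ n₂ y s = n₂ ^ 2 := by
  rw [bangBang, if_pos h]; ring

lemma bangBang_of_nonpos {n₁ n₂ : ℝ} {y : ℝ → ℂ} {s : ℝ} (h : (y s ^ 2).im ≤ 0) :
    bangBang n₁ n₂ y s = n₁ ^ 2 := by
  rw [bangBang, if_neg h.not_gt]; ring

lemma le_bangBang {n₁ n₂ : ℝ} (hn₁ : 0 < n₁) (hn : n₁ < n₂) (y : ℝ → ℂ) (s : ℝ) :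
    n₁ ^ 2 ≤ bangBang n₁ n₂ y s := by
  rcases lt_or_ge 0 (y s ^ 2).im with h | h
  · rw [bangBang_of_pos h]; gcongr
  · rw [bangBang_of_nonpos h]

lemma not_isSwitchPoint_of_eventually_eq {ε : ℝ → ℝ} {c e : ℝ} (h : ∀ᶠ s in 𝓝[≠] c, ε s = e) :
    ¬ IsSwitchPoint ε c := by
  rintro ⟨l, r, hl, hr, hlr⟩
  have h1 : Tendsto ε (𝓝[≠] c) (𝓝 e) := tendsto_const_nhds.congr' (h.mono fun s hs => hs.symm)
  exact hlr ((tendsto_nhds_unique hl (h1.mono_left (nhdsLT_le_nhdsNE c))).trans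
    (tendsto_nhds_unique hr (h1.mono_left (nhdsGT_le_nhdsNE c))).symm)

/-! ### Rotation, switch points and the conserved quantity of an extremal tuple -/

section Tuple

variable {κ : ℂ} {n₁ n₂ : ℝ} {x : ℝ → OnePoint ℂ} {ε : ℝ → ℝ} {lam : ℝ} {y : ℝ → ℂ}

lemma IsExtendedExtremal.hasDerivAt (h : IsExtendedExtremal κ n₁ n₂ x ε lam y) (s : ℝ) :
    HasDerivAt y (deriv y s) s := (h.differentiable s).hasDerivAt

lemma IsExtendedExtremal.continuous_deriv (h : IsExtendedExtremal κ n₁ n₂ x ε lam y) :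
    Continuous (deriv y) := h.locallyLipschitz_deriv.continuous

lemma IsExtendedExtremal.continuous (h : IsExtendedExtremal κ n₁ n₂ x ε lam y) :
    Continuous y := h.differentiable.continuous

lemma IsExtendedExtremal.continuous_im_sq (h : IsExtendedExtremal κ n₁ n₂ x ε lam y) :
    Continuous fun s => (y s ^ 2).im := Complex.continuous_im.comp (h.continuous.pow 2)

lemma IsExtendedExtremal.control_of_pos (h : IsExtendedExtremal κ n₁ n₂ x ε lam y) {s : ℝ}
    (hs : 0 < (y s ^ 2).im) : ε s = n₂ ^ 2 := by rw [h.control_eq, bangBang_of_pos hs]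

lemma IsExtendedExtremal.control_of_nonpos (h : IsExtendedExtremal κ n₁ n₂ x ε lam y) {s : ℝ}
    (hs : (y s ^ 2).im ≤ 0) : ε s = n₁ ^ 2 := by rw [h.control_eq, bangBang_of_nonpos hs]

/-- The quantity `Im (y' ȳ) = |y|² (arg y)'` increases strictly, because `Im κ² < 0`. -/
lemma IsExtendedExtremal.strictMono_im_deriv_mul_conj (h : IsExtendedExtremal κ n₁ n₂ x ε lam y)
    (hκre : 0 < κ.re) (hκim : κ.im < 0) (hn₁ : 0 < n₁) (hn : n₁ < n₂) (hlam : 0 < lam) :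
    StrictMono fun s => (deriv y s * (starRingEnd ℂ) (y s)).im := by
  have hκ2 : 0 < -(κ ^ 2).im := by
    rw [sq, Complex.mul_im]; nlinarith [mul_pos hκre (neg_pos.2 hκim)]
  -- `m |y|²` bounds the a.e. derivative of `Im (y' ȳ)` from below, so subtracting its integral
  -- still leaves a monotone function.
  set m : ℝ := -(κ ^ 2).im * n₁ ^ 2
  have hm : 0 < m := by positivity
  have hcont : Continuous fun s => Complex.normSq (y s) :=
    Complex.continuous_normSq.comp h.continuous
  have hint : ∀ s, HasDerivAt (fun s => ∫ t in (0 : ℝ)..s, Complex.normSq (y t))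
      (Complex.normSq (y s)) s := fun s =>
    intervalIntegral.integral_hasDerivAt_right (hcont.intervalIntegrable _ _)
      (hcont.stronglyMeasurableAtFilter _ _) hcont.continuousAt
  have hmono : Monotone fun s => (deriv y s * (starRingEnd ℂ) (y s)).im +
      -m * ∫ t in (0 : ℝ)..s, Complex.normSq (y t) := by
    refine monotone_of_ae_hasDerivAt_nonneg (f' := fun s =>
      (-(κ ^ 2).im * (bangBang n₁ n₂ y s - n₁ ^ 2)) * Complex.normSq (y s)) ?_ ?_ ?_
    · have hB : LocallyLipschitz fun p : ℂ × ℂ => (p.1 * (starRingEnd ℂ) p.2).im := by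
        refine ContDiff.locallyLipschitz (𝕂 := ℝ) ?_
        exact Complex.imCLM.contDiff.comp
          (contDiff_fst.mul (Complex.conjCLE.contDiff.comp contDiff_snd))
      refine LocallyLipschitz.add
        (hB.comp (h.locallyLipschitz_deriv.prodMk
          (locallyLipschitz_of_hasDerivAt h.hasDerivAt h.continuous_deriv))) ?_
      exact locallyLipschitz_of_hasDerivAt (fun s => (hint s).const_mul (-m))
        (continuous_const.mul hcont)
    · filter_upwards [h.equation] with s hs
      have h1 : HasDerivAt (fun s => (starRingEnd ℂ) (y s)) ((starRingEnd ℂ) (deriv y s)) s :=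
        Complex.conjCLE.toContinuousLinearMap.hasFDerivAt.comp_hasDerivAt s (h.hasDerivAt s)
      have h2 := Complex.imCLM.hasFDerivAt.comp_hasDerivAt s (hs.mul h1)
      refine (h2.add ((hint s).const_mul (-m))).congr_deriv ?_
      simp only [m, Complex.imCLM_apply, Complex.add_im, Complex.mul_im, Complex.mul_re,
        Complex.neg_im, Complex.neg_re, Complex.conj_re, Complex.conj_im, Complex.ofReal_re,
        Complex.ofReal_im, Complex.normSq_apply]
      ring
    · intro s
      exact mul_nonneg (mul_nonneg hκ2.le (sub_nonneg.2 (le_bangBang hn₁ hn y s)))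
        (Complex.normSq_nonneg _)
  intro s t hst
  have h1 := hmono hst.le
  have h2 : 0 < ∫ r in s..t, Complex.normSq (y r) := by
    refine intervalIntegral.integral_pos hst hcont.continuousOn
      (fun r _ => Complex.normSq_nonneg _) ?_
    -- If `y` vanished on an interval the conserved quantity would be zero there, against `lam > 0`.
    by_contra! hall
    have hzero : ∀ r ∈ Set.Icc s t, y r = 0 := fun r hr =>
      Complex.normSq_eq_zero.1 (le_antisymm (hall r hr) (Complex.normSq_nonneg _))
    have hmid : (s + t) / 2 ∈ Set.Ioo s t := ⟨by linarith, by linarith⟩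
    have hd : deriv y ((s + t) / 2) = 0 := by
      have : y =ᶠ[𝓝 ((s + t) / 2)] fun _ => 0 := by
        filter_upwards [Ioo_mem_nhds hmid.1 hmid.2] with r hr using hzero r ⟨hr.1.le, hr.2.le⟩
      rw [this.deriv_eq, deriv_const]
    have hc := h.conserved ((s + t) / 2)
    rw [hd, hzero _ ⟨hmid.1.le, hmid.2.le⟩] at hc
    simp at hc
    exact hlam.ne hc
  rw [← intervalIntegral.integral_interval_sub_left (hcont.intervalIntegrable 0 t)
    (hcont.intervalIntegrable 0 s)] at h2
  have h3 := mul_pos hm h2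
  simp only at h1 ⊢
  linarith

/-- The control does not switch at the zeros of `y`. -/
lemma IsExtendedExtremal.ne_zero_of_isSwitchPoint (h : IsExtendedExtremal κ n₁ n₂ x ε lam y)
    (hκre : 0 < κ.re) (hκim : κ.im < 0) (hn₁ : 0 < n₁) (hn : n₁ < n₂) (hlam : 0 < lam) {c : ℝ}
    (hc : IsSwitchPoint ε c) : y c ≠ 0 := by
  intro hy
  have sq_im : ∀ z : ℂ, (z ^ 2).im = 2 * z.re * z.im := fun z => by
    rw [sq, Complex.mul_im]; ring
  have hslope : Tendsto (slope y c) (𝓝[≠] c) (𝓝 (deriv y c)) :=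
    hasDerivAt_iff_tendsto_slope.1 (h.hasDerivAt c)
  have hys : ∀ s, y s = ((s - c : ℝ) : ℂ) * slope y c s := fun s => by
    have := sub_smul_slope y c s
    rw [vsub_eq_sub, hy, sub_zero, Complex.real_smul] at this
    exact this.symm
  have hysq : ∀ s, (y s ^ 2).im = (s - c) ^ 2 * (slope y c s ^ 2).im := fun s => by
    rw [hys, mul_pow, ← Complex.ofReal_pow, Complex.im_ofReal_mul]
  have hsq : Tendsto (fun s => (slope y c s ^ 2).im) (𝓝[≠] c) (𝓝 (deriv y c ^ 2).im) :=
    (Complex.continuous_im.tendsto _).comp (hslope.pow 2)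
  have hcons := h.conserved c
  rw [hy] at hcons
  rcases lt_trichotomy (deriv y c ^ 2).im 0 with hd | hd | hd
  · refine not_isSwitchPoint_of_eventually_eq (e := n₁ ^ 2) ?_ hc
    filter_upwards [hsq.eventually_lt_const hd] with s hs
    refine h.control_of_nonpos ?_
    rw [hysq]
    exact mul_nonpos_of_nonneg_of_nonpos (sq_nonneg _) hs.le
  -- In this degenerate case `lam > 0` and `Im κ⁻² > 0` force `y' c` to be real and nonzero. Then
  -- the tangent `f` of the argument extends by zero to `c`, and `f' = W / (Re y)²` changes sign
  -- from negative to positive there. So `f > 0`, hence `Im y² > 0`, on both sides.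
  · have hdre : 0 < (deriv y c ^ 2).re := by
      have hκinv : 0 < ((κ ^ 2)⁻¹).im := by
        have h0 : 0 < Complex.normSq (κ ^ 2) :=
          Complex.normSq_pos.2 (pow_ne_zero 2 (by rintro rfl; simp at hκre))
        rw [Complex.inv_im]
        refine div_pos ?_ h0
        rw [sq_im]; nlinarith [mul_pos hκre (neg_pos.2 hκim)]
      simp only [ne_eq, OfNat.ofNat_ne_zero, not_false_eq_true, zero_pow, mul_zero, zero_add] at hcons
      rw [Complex.mul_im, hd, mul_zero, zero_add] at hcons
      rw [← hcons] at hlam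
      exact (pos_iff_pos_of_mul_pos hlam).1 hκinv
    have hdim : (deriv y c).im = 0 ∧ (deriv y c).re ≠ 0 := by
      rw [sq, Complex.mul_re] at hdre
      rw [sq_im] at hd
      have hre : (deriv y c).re ≠ 0 := by
        intro h0; rw [h0] at hdre; nlinarith [sq_nonneg (deriv y c).im]
      exact ⟨by simpa [hre] using hd, hre⟩
    have hre : ∀ s, HasDerivAt (fun s => (y s).re) (deriv y s).re s := fun s =>
      Complex.reCLM.hasFDerivAt.comp_hasDerivAt s (h.hasDerivAt s)
    have him : ∀ s, HasDerivAt (fun s => (y s).im) (deriv y s).im s := fun s =>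
      Complex.imCLM.hasFDerivAt.comp_hasDerivAt s (h.hasDerivAt s)
    have hp : ∀ᶠ s in 𝓝[≠] c, (y s).re ≠ 0 := (hre c).eventually_ne hdim.2
    obtain ⟨δ, hδ, hball⟩ := Metric.eventually_nhds_iff.1 (eventually_nhdsWithin_iff.1 hp)
    set f : ℝ → ℝ := fun s => (y s).im / (y s).re with hf
    have hfc : f c = 0 := by simp [hf, hy]
    have hW := h.strictMono_im_deriv_mul_conj hκre hκim hn₁ hn hlam
    have hWc : (deriv y c * (starRingEnd ℂ) (y c)).im = 0 := by simp [hy]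
    have hder : ∀ s, (y s).re ≠ 0 → HasDerivAt f
        ((deriv y s * (starRingEnd ℂ) (y s)).im / (y s).re ^ 2) s := fun s hs => by
      refine ((him s).fun_div (hre s) hs).congr_deriv ?_
      simp only [Complex.mul_im, Complex.conj_re, Complex.conj_im]
      congr 1; ring
    have hcontc : ContinuousAt f c := by
      rw [continuousAt_iff_punctured_nhds, hfc]
      have h1 : Tendsto (fun s => (slope y c s).im / (slope y c s).re) (𝓝[≠] c) (𝓝 0) := by
        have := (((Complex.continuous_im.tendsto _).comp hslope).div
          ((Complex.continuous_re.tendsto _).comp hslope) hdim.2)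
        rw [hdim.1, zero_div] at this
        exact this
      refine h1.congr' ?_
      filter_upwards [self_mem_nhdsWithin] with s hs
      have hs' : s - c ≠ 0 := sub_ne_zero.2 hs
      simp only [hf]
      rw [hys s, Complex.im_ofReal_mul, Complex.re_ofReal_mul, mul_div_mul_left _ _ hs']
    have hpne : ∀ s, |s - c| < δ → s ≠ c → (y s).re ≠ 0 := fun s hs hne =>
      hball (by rwa [Real.dist_eq]) hne
    have hfcont : ∀ s, |s - c| < δ → ContinuousAt f s := fun s hs => by
      by_cases hsc : s = c
      · rw [hsc]; exact hcontc
      · exact (hder s (hpne s hs hsc)).continuousAt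
    refine not_isSwitchPoint_of_eventually_eq (e := n₂ ^ 2) ?_ hc
    rw [eventually_nhdsWithin_iff, Metric.eventually_nhds_iff]
    refine ⟨δ, hδ, fun s hs hne => h.control_of_pos ?_⟩
    rw [Real.dist_eq] at hs
    have hsne := hpne s hs hne
    have hfs : 0 < f s := by
      rw [← hfc]
      rw [abs_lt] at hs
      rcases (show s ≠ c from hne).lt_or_gt with hlt | hgt
      · refine strictAntiOn_of_deriv_neg (convex_Icc s c)
          (fun t ht => (hfcont t (abs_lt.2 ⟨by linarith [ht.1], by linarith [ht.2]⟩)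
            ).continuousWithinAt) (fun t ht => ?_)
          (Set.left_mem_Icc.2 hlt.le) (Set.right_mem_Icc.2 hlt.le) hlt
        rw [interior_Icc] at ht
        have hn := hpne t (abs_lt.2 ⟨by linarith [ht.1], by linarith [ht.2]⟩) ht.2.ne
        rw [(hder t hn).deriv]
        exact div_neg_of_neg_of_pos (hWc ▸ hW ht.2) (by positivity)
      · refine strictMonoOn_of_deriv_pos (convex_Icc c s)
          (fun t ht => (hfcont t (abs_lt.2 ⟨by linarith [ht.1], by linarith [ht.2]⟩)
            ).continuousWithinAt) (fun t ht => ?_)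
          (Set.left_mem_Icc.2 hgt.le) (Set.right_mem_Icc.2 hgt.le) hgt
        rw [interior_Icc] at ht
        have hn := hpne t (abs_lt.2 ⟨by linarith [ht.1], by linarith [ht.2]⟩) ht.1.ne'
        rw [(hder t hn).deriv]
        exact div_pos (hWc ▸ hW ht.1) (by positivity)
    have : (y s ^ 2).im = 2 * ((y s).re ^ 2 * f s) := by
      rw [sq_im]; simp only [hf]; field_simp
    rw [this]
    positivity
  · refine not_isSwitchPoint_of_eventually_eq (e := n₂ ^ 2) ?_ hc
    filter_upwards [hsq.eventually_const_lt hd, self_mem_nhdsWithin] with s hs hne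
    refine h.control_of_pos ?_
    rw [hysq]
    have : s - c ≠ 0 := sub_ne_zero.2 hne
    positivity

/-- Where `Im y²` is nonzero its sign persists nearby, so the control is locally constant. -/
lemma IsExtendedExtremal.im_sq_eq_zero_of_isSwitchPoint
    (h : IsExtendedExtremal κ n₁ n₂ x ε lam y) {c : ℝ} (hc : IsSwitchPoint ε c) :
    (y c ^ 2).im = 0 := by
  rcases lt_trichotomy (y c ^ 2).im 0 with hd | hd | hd
  · refine absurd hc (not_isSwitchPoint_of_eventually_eq (e := n₁ ^ 2) ?_)
    filter_upwards [nhdsWithin_le_nhds (h.continuous_im_sq.continuousAt.eventually_lt_const hd)]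
      with s hs using h.control_of_nonpos hs.le
  · exact hd
  · refine absurd hc (not_isSwitchPoint_of_eventually_eq (e := n₂ ^ 2) ?_)
    filter_upwards [nhdsWithin_le_nhds (h.continuous_im_sq.continuousAt.eventually_const_lt hd)]
      with s hs using h.control_of_pos hs

/-- The control switches wherever `y²` crosses the real axis transversally. -/
lemma IsExtendedExtremal.isSwitchPoint_of_im_sq_eq_zero
    (h : IsExtendedExtremal κ n₁ n₂ x ε lam y) (hn₁ : 0 < n₁) (hn : n₁ < n₂) {c : ℝ}
    (hc : (y c ^ 2).im = 0) (hd : (2 * y c * deriv y c).im ≠ 0) : IsSwitchPoint ε c := by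
  have hder : HasDerivAt (fun s => (y s ^ 2).im) (2 * y c * deriv y c).im c := by
    refine (Complex.imCLM.hasFDerivAt.comp_hasDerivAt c ((h.hasDerivAt c).fun_pow 2)).congr_deriv ?_
    simp
  have hsq : n₁ ^ 2 ≠ n₂ ^ 2 := (show n₁ ^ 2 < n₂ ^ 2 by gcongr).ne
  rcases hd.lt_or_gt with hd | hd
  · have hs := eventually_nhdsWithin_sign_eq_of_deriv_neg
      (f := fun s => (y s ^ 2).im) (by rwa [hder.deriv]) hc
    refine ⟨n₂ ^ 2, n₁ ^ 2, tendsto_const_nhds.congr' ?_, tendsto_const_nhds.congr' ?_, hsq.symm⟩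
    · filter_upwards [nhdsWithin_le_nhds hs, self_mem_nhdsWithin] with s hs hlt
      rw [sign_pos (sub_pos.2 hlt), sign_eq_one_iff] at hs
      exact (h.control_of_pos hs).symm
    · filter_upwards [nhdsWithin_le_nhds hs, self_mem_nhdsWithin] with s hs hlt
      rw [sign_neg (sub_neg.2 hlt), sign_eq_neg_one_iff] at hs
      exact (h.control_of_nonpos hs.le).symm
  · have hs := eventually_nhdsWithin_sign_eq_of_deriv_pos
      (f := fun s => (y s ^ 2).im) (by rwa [hder.deriv]) hc
    refine ⟨n₁ ^ 2, n₂ ^ 2, tendsto_const_nhds.congr' ?_, tendsto_const_nhds.congr' ?_, hsq⟩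
    · filter_upwards [nhdsWithin_le_nhds hs, self_mem_nhdsWithin] with s hs hlt
      rw [sign_neg (sub_neg.2 hlt), sign_eq_neg_one_iff] at hs
      exact (h.control_of_nonpos hs.le).symm
    · filter_upwards [nhdsWithin_le_nhds hs, self_mem_nhdsWithin] with s hs hlt
      rw [sign_pos (sub_pos.2 hlt), sign_eq_one_iff] at hs
      exact (h.control_of_pos hs).symm

/-- Through a layer `y` solves an equation with constant coefficient. -/
lemma IsExtendedExtremal.hasDerivAt_deriv_of_control_eq
    (h : IsExtendedExtremal κ n₁ n₂ x ε lam y) {a b e : ℝ}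
    (he : ∀ s ∈ Set.Ioo a b, ε s = e) {s : ℝ} (hs : s ∈ Set.Ioo a b) :
    HasDerivAt (deriv y) (-(κ ^ 2 * e * y s)) s := by
  have hab : a < b := hs.1.trans hs.2
  have hint : ∀ s, HasDerivAt (fun s => ∫ t in a..s, y t) (y s) s := fun s =>
    intervalIntegral.integral_hasDerivAt_right (h.continuous.intervalIntegrable _ _)
      (h.continuous.stronglyMeasurableAtFilter _ _) h.continuous.continuousAt
  -- Adding the integral of `κ² e y` makes the a.e. derivative vanish on the layer. The sum is
  -- therefore constant, and the equation holds at every interior point.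
  have hlip : LocallyLipschitz fun s => deriv y s + κ ^ 2 * e * ∫ t in a..s, y t :=
    h.locallyLipschitz_deriv.add (locallyLipschitz_of_hasDerivAt
      (fun s => (hint s).const_mul (κ ^ 2 * e : ℂ)) (continuous_const.mul h.continuous))
  obtain ⟨C, hC⟩ := (absolutelyContinuousOnInterval_of_locallyLipschitz hlip a b
    ).const_of_ae_hasDerivAt_zero (by
      filter_upwards [h.equation, compl_mem_ae_iff.2 (measure_singleton a),
        compl_mem_ae_iff.2 (measure_singleton b)] with t ht hta htb htI
      rw [Set.uIcc_of_le hab.le] at htI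
      have htI' : t ∈ Set.Ioo a b := ⟨htI.1.lt_of_ne (Ne.symm hta), htI.2.lt_of_ne htb⟩
      rw [← h.control_eq, he t htI'] at ht
      refine (ht.add ((hint t).const_mul (κ ^ 2 * e : ℂ))).congr_deriv ?_
      ring)
  have hd : HasDerivAt (fun s => C - κ ^ 2 * e * ∫ t in a..s, y t) (-(κ ^ 2 * e * y s)) s :=
    ((hint s).const_mul (κ ^ 2 * e : ℂ)).const_sub C
  refine hd.congr_of_eventuallyEq ?_
  filter_upwards [Ioo_mem_nhds hs.1 hs.2] with t ht
  rw [← hC t (by rw [Set.uIcc_of_le hab.le]; exact ⟨ht.1.le, ht.2.le⟩)]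
  ring

lemma IsExtendedExtremal.state_of_ne_zero (h : IsExtendedExtremal κ n₁ n₂ x ε lam y) {s : ℝ}
    (hs : y s ≠ 0) : x s = ((deriv y s / (Complex.I * κ * y s) : ℂ) : OnePoint ℂ) := by
  rw [h.state_eq, phaseState, if_neg hs]

lemma IsExtendedExtremal.of_state_mem_image (h : IsExtendedExtremal κ n₁ n₂ x ε lam y) {s : ℝ}
    {S : Set ℂ} (hs : x s ∈ ((↑) : ℂ → OnePoint ℂ) '' S) :
    y s ≠ 0 ∧ deriv y s / (Complex.I * κ * y s) ∈ S := by
  obtain ⟨w, hw, hws⟩ := hs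
  rw [h.state_eq, phaseState] at hws
  split_ifs at hws with hy
  · exact absurd hws (OnePoint.coe_ne_infty w)
  · exact ⟨hy, OnePoint.coe_injective hws ▸ hw⟩

lemma im_deriv_mul_conj_eq (hκ : κ ≠ 0) {d w : ℂ} (hw : w ≠ 0) :
    (d * (starRingEnd ℂ) w).im = Complex.normSq w * (κ * (d / (Complex.I * κ * w))).re := by
  have h1 : d * (starRingEnd ℂ) w =
      (Complex.normSq w : ℂ) * (Complex.I * (κ * (d / (Complex.I * κ * w)))) := by
    rw [← Complex.mul_conj]
    have := Complex.I_ne_zero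
    field_simp
  rw [h1, Complex.im_ofReal_mul, Complex.I_mul_im]

/-- At a switch point the conserved quantity determines `Im (x² y²)`. -/
lemma IsExtendedExtremal.im_state_sq_mul_sq (h : IsExtendedExtremal κ n₁ n₂ x ε lam y)
    (hκ : κ ≠ 0) {c : ℝ} (hy : y c ≠ 0) (hc : (y c ^ 2).im = 0) :
    ((deriv y c / (Complex.I * κ * y c)) ^ 2 * y c ^ 2).im = -lam := by
  have h1 := h.conserved c
  rw [Complex.add_im, Complex.im_ofReal_mul, hc, mul_zero, zero_add] at h1
  have h2 : (deriv y c / (Complex.I * κ * y c)) ^ 2 * y c ^ 2 = -((κ ^ 2)⁻¹ * deriv y c ^ 2) := by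
    rw [div_pow, mul_pow, mul_pow, Complex.I_sq]
    field_simp
  rw [h2, Complex.neg_im, h1]

end Tuple

/-! ### One layer: reduction to the normalised quarter turn -/

lemma pos_of_ne_zero_on_Ioo {f : ℝ → ℝ} {a b m : ℝ} (hf : ContinuousOn f (Set.Ioo a b))
    (hne : ∀ s ∈ Set.Ioo a b, f s ≠ 0) (hm : m ∈ Set.Ioo a b) (hpos : 0 < f m) :
    ∀ s ∈ Set.Ioo a b, 0 < f s := by
  intro s hs
  by_contra! hle
  obtain ⟨t, ht, ht0⟩ := isPreconnected_Ioo.intermediate_value hs hm hf ⟨hle, hpos.le⟩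
  exact hne t ht ht0

lemma re_ne_zero_of_im_sq_mul_ne_zero {z w : ℂ} (hw : (w ^ 2).im = 0)
    (h : (z ^ 2 * w ^ 2).im ≠ 0) : z.re ≠ 0 := by
  intro h0
  apply h
  rw [Complex.mul_im, hw, sq z, Complex.mul_im, h0]
  ring

/-- Both sign cases come from one quarter turn, run forwards if `W > 0` in the layer and backwards
if `W < 0`. -/
theorem layer_alternative {κ : ℂ} (hκre : 0 < κ.re) (hκim : κ.im < 0)
    {n₁ n₂ : ℝ} (hn₁ : 0 < n₁) (hn : n₁ < n₂)
    {x : ℝ → OnePoint ℂ} {ε : ℝ → ℝ} {lam : ℝ} {y : ℝ → ℂ}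
    (hext : IsExtendedExtremal κ n₁ n₂ x ε lam y) (hnormal : 0 < lam)
    {b b' ϵ : ℝ} (hlayer : IsLayer ε b b' ϵ)
    (hsec : ∀ s ∈ Set.Ioo b b', x s ∈ ((↑) : ℂ → OnePoint ℂ) '' ordinaryRegion κ) :
    y b ≠ 0 ∧ y b' ≠ 0 ∧
    (deriv y b / (Complex.I * κ * y b)).im * (deriv y b' / (Complex.I * κ * y b')).im < 0 ∧
    (0 < (deriv y b / (Complex.I * κ * y b)).im →
      b' - b < Real.pi / (2 * Real.sqrt ϵ * κ.re)) ∧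
    ((deriv y b / (Complex.I * κ * y b)).im < 0 →
      Real.pi / (2 * Real.sqrt ϵ * κ.re) < b' - b ∧
      b' - b < Real.pi / (Real.sqrt ϵ * κ.re)) := by
  have hκ : κ ≠ 0 := by rintro rfl; simp at hκre
  have hlt := hlayer.lt
  have hyb := hext.ne_zero_of_isSwitchPoint hκre hκim hn₁ hn hnormal hlayer.left_switch
  have hyb' := hext.ne_zero_of_isSwitchPoint hκre hκim hn₁ hn hnormal hlayer.right_switch
  have himb := hext.im_sq_eq_zero_of_isSwitchPoint hlayer.left_switch
  have himb' := hext.im_sq_eq_zero_of_isSwitchPoint hlayer.right_switch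
  have hcb := hext.im_state_sq_mul_sq hκ hyb himb
  have hcb' := hext.im_state_sq_mul_sq hκ hyb' himb'
  set z : ℝ → ℂ := fun s => deriv y s / (Complex.I * κ * y s) with hz
  have hzb : deriv y b / (Complex.I * κ * y b) = z b := rfl
  have hzb' : deriv y b' / (Complex.I * κ * y b') = z b' := rfl
  rw [hzb] at hcb
  rw [hzb'] at hcb'
  rw [hzb, hzb']
  have hI0 : ∀ s ∈ Set.Ioo b b', y s ≠ 0 := fun s hs => (hext.of_state_mem_image (hsec s hs)).1
  have hIz : ∀ s ∈ Set.Ioo b b',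
      (0 < (z s).re ∧ 0 < (κ * z s).re) ∨ ((z s).re < 0 ∧ (κ * z s).re < 0) :=
    fun s hs => mem_sector_re hκre hκim (hext.of_state_mem_image (hsec s hs)).2
  have hyne : ∀ s ∈ Set.Icc b b', y s ≠ 0 := by
    intro s hs
    rcases hs.1.eq_or_lt with rfl | h1
    · exact hyb
    rcases hs.2.eq_or_lt with rfl | h2
    · exact hyb'
    exact hI0 s ⟨h1, h2⟩
  have hderiv : ∀ s ∈ Set.Icc b b', deriv y s = Complex.I * κ * z s * y s := fun s hs => by
    have h1 := hyne s hs
    have h2 := Complex.I_ne_zero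
    simp only [hz]
    field_simp
  set W : ℝ → ℝ := fun s => (deriv y s * (starRingEnd ℂ) (y s)).im with hWdef
  have hWmono : StrictMono W :=
    hext.strictMono_im_deriv_mul_conj hκre hκim hn₁ hn hnormal
  have hWz : ∀ s ∈ Set.Icc b b', W s = Complex.normSq (y s) * (κ * z s).re :=
    fun s hs => im_deriv_mul_conj_eq hκ (hyne s hs)
  have hWcont : Continuous W := Complex.continuous_im.comp
    (hext.continuous_deriv.mul (Complex.continuous_conj.comp hext.continuous))
  -- Where `y²` is real, `Im (y²)' = 2 Re (κ z) Re (y²) ≠ 0`, so the control would switch inside the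
  -- layer.
  have hIim : ∀ s ∈ Set.Ioo b b', (y s ^ 2).im ≠ 0 := by
    intro s hs h0
    refine hlayer.no_switch s hs (hext.isSwitchPoint_of_im_sq_eq_zero hn₁ hn h0 ?_)
    have hs' : s ∈ Set.Icc b b' := ⟨hs.1.le, hs.2.le⟩
    have e : 2 * y s * deriv y s = 2 * (Complex.I * (κ * z s)) * y s ^ 2 := by
      rw [hderiv s hs']; ring
    have hre : (y s ^ 2).re ≠ 0 := fun hr =>
      pow_ne_zero 2 (hI0 s hs) (Complex.ext hr h0)
    have hκz : (κ * z s).re ≠ 0 := by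
      rcases hIz s hs with h | h
      · exact h.2.ne'
      · exact h.2.ne
    have e' : (2 * (Complex.I * (κ * z s))).im = 2 * (κ * z s).re := by simp
    rw [e, Complex.mul_im, h0, mul_zero, zero_add, e']
    positivity
  set m := (b + b') / 2
  have hm : m ∈ Set.Ioo b b' := ⟨by simp only [m]; linarith, by simp only [m]; linarith⟩
  obtain ⟨e, he0, he⟩ : ∃ e, 0 < e ∧ ∀ s ∈ Set.Ioo b b', ε s = e := by
    rcases (hIim m hm).lt_or_gt with h | h
    · refine ⟨n₁ ^ 2, by positivity, fun s hs => hext.control_of_nonpos ?_⟩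
      have := pos_of_ne_zero_on_Ioo (f := fun s => -(y s ^ 2).im)
        hext.continuous_im_sq.neg.continuousOn (fun s hs => neg_ne_zero.2 (hIim s hs)) hm
        (neg_pos.2 h) s hs
      linarith
    · refine ⟨n₂ ^ 2, by have := hn₁.trans hn; positivity, fun s hs => hext.control_of_pos ?_⟩
      exact pos_of_ne_zero_on_Ioo hext.continuous_im_sq.continuousOn hIim hm h s hs
  have heϵ : ϵ = e := by
    refine tendsto_nhds_unique hlayer.permittivity (tendsto_const_nhds.congr' ?_)
    filter_upwards [Ioo_mem_nhdsGT hlt] with s hs using (he s hs).symm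
  subst heϵ
  have hV' : ∀ s ∈ Set.Ioo b b', HasDerivAt (deriv y) (-((κ * Real.sqrt ϵ) ^ 2 * y s)) s := by
    intro s hs
    have := hext.hasDerivAt_deriv_of_control_eq he hs
    rwa [mul_pow, ← Complex.ofReal_pow, Real.sq_sqrt he0.le]
  set r := Real.sqrt ϵ with hrdef
  have hr : 0 < r := Real.sqrt_pos.2 he0
  have hrC : (r : ℂ) ≠ 0 := Complex.ofReal_ne_zero.2 hr.ne'
  have hkre : 0 < (κ * r).re := by rw [Complex.re_mul_ofReal]; positivity
  have hkim : (κ * r).im < 0 := by rw [Complex.im_mul_ofReal]; exact mul_neg_of_neg_of_pos hκim hr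
  have hzcont : ∀ s ∈ Set.Icc b b', ContinuousAt z s := fun s hs =>
    hext.continuous_deriv.continuousAt.div (continuousAt_const.mul hext.continuous.continuousAt)
      (mul_ne_zero (mul_ne_zero Complex.I_ne_zero hκ) (hyne s hs))
  -- The region hypothesis says nothing about the ends. Limits give weak signs of `Re z` there, and
  -- `hzre`, `hzre'` make them strict.
  have hzclosure : ∀ f : ℂ → ℝ, Continuous f → (∀ s ∈ Set.Ioo b b', 0 < f (z s)) →
      0 ≤ f (z b) ∧ 0 ≤ f (z b') := by
    intro f hf hpos
    have hb : b ∈ Set.Icc b b' := ⟨le_rfl, hlt.le⟩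
    have hb' : b' ∈ Set.Icc b b' := ⟨hlt.le, le_rfl⟩
    have h1 : Tendsto (fun s => f (z s)) (𝓝[>] b) (𝓝 (f (z b))) :=
      (hf.continuousAt.comp (hzcont b hb)).continuousWithinAt
    have h2 : Tendsto (fun s => f (z s)) (𝓝[<] b') (𝓝 (f (z b'))) :=
      (hf.continuousAt.comp (hzcont b' hb')).continuousWithinAt
    constructor
    · refine ge_of_tendsto h1 ?_
      filter_upwards [Ioo_mem_nhdsGT hlt] with s hs using (hpos s hs).le
    · refine ge_of_tendsto h2 ?_
      filter_upwards [Ioo_mem_nhdsLT hlt] with s hs using (hpos s hs).le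
  have hzre : (z b).re ≠ 0 := re_ne_zero_of_im_sq_mul_ne_zero himb (by rw [hcb]; linarith)
  have hzre' : (z b').re ≠ 0 := re_ne_zero_of_im_sq_mul_ne_zero himb' (by rw [hcb']; linarith)
  have hWsign : ∀ s ∈ Set.Ioo b b', (0 < W s ↔ 0 < (z s).re) ∧ (W s < 0 ↔ (z s).re < 0) := by
    intro s hs
    have hns : 0 < Complex.normSq (y s) := Complex.normSq_pos.2 (hI0 s hs)
    rw [hWz s ⟨hs.1.le, hs.2.le⟩]
    rcases hIz s hs with h | h
    · have := mul_pos hns h.2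
      exact ⟨iff_of_true this h.1, iff_of_false this.le.not_gt h.1.le.not_gt⟩
    · have := mul_neg_of_pos_of_neg hns h.2
      exact ⟨iff_of_false this.le.not_gt h.1.le.not_gt, iff_of_true this h.1⟩
  have hWne : ∀ s ∈ Set.Ioo b b', W s ≠ 0 := by
    intro s hs h0
    have h1 := hWsign s hs
    rw [h0] at h1
    rcases hIz s hs with h | h
    · exact lt_irrefl _ (h1.1.2 h.1)
    · exact lt_irrefl _ (h1.2.2 h.1)
  have hrk : ∀ w : ℂ, Complex.I * (κ * r) * (w / r) = Complex.I * κ * w := fun w => by field_simp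
  have hdivsq : ∀ w u : ℂ, ((w / r) ^ 2 * u).im = (w ^ 2 * u).im / r ^ 2 := fun w u => by
    rw [div_pow, div_mul_eq_mul_div, ← Complex.ofReal_pow, Complex.div_ofReal_im]
  have hcne : -lam / r ^ 2 ≠ 0 := div_ne_zero (neg_ne_zero.2 hnormal.ne') (by positivity)
  have hL : 0 < b' - b := sub_pos.2 hlt
  refine ⟨hyb, hyb', ?_⟩
  rcases (hWne m hm).lt_or_gt with hWm | hWm
  · have hWI : ∀ s ∈ Set.Ioo b b', 0 < -W s := pos_of_ne_zero_on_Ioo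
      (f := fun s => -W s) hWcont.neg.continuousOn (fun s hs => neg_ne_zero.2 (hWne s hs)) hm
      (neg_pos.2 hWm)
    obtain ⟨h1, h2⟩ := hzclosure (fun w => -w.re) Complex.continuous_re.neg
      (fun s hs => neg_pos.2 ((hWsign s hs).2.1 (neg_pos.1 (hWI s hs))))
    -- Reversing time swaps the ends and negates `z`. Since `Im z` has opposite signs at `b` and
    -- `b'`, the new initial value `-z b' / r` has an imaginary part of the same sign as that of `z
    -- b`.
    have key := quarter_turn_duration (Y := fun s => y (b' - s)) (V := fun s => -deriv y (b' - s))
      (k := κ * r) (z₀ := -z b' / r) (z₁ := -z b / r) (L := b' - b) (c := -lam / r ^ 2)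
      hkre hkim hL
      (hext.continuous.comp (continuous_const.sub continuous_id)).continuousOn
      (hext.continuous_deriv.comp (continuous_const.sub continuous_id)).neg.continuousOn
      (fun s _ => (hext.hasDerivAt (b' - s)).comp_const_sub b' s)
      (fun s hs => by
        have := (hV' (b' - s) ⟨by linarith [hs.2], by linarith [hs.1]⟩).comp_const_sub b' s
        simpa using this.fun_neg)
      (fun s hs => by
        -- `s` may equal the full length, so strict monotonicity carries the sign from an interior
        -- point to the end `b`.
        have hneg : W (b' - s) < 0 := by
          have hm' : W (b' - s) < W (b' - s / 2) := hWmono (by linarith [hs.1])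
          have := hWI (b' - s / 2) ⟨by linarith [hs.2], by linarith [hs.1]⟩
          linarith
        have e : W (b' - s) = (deriv y (b' - s) * (starRingEnd ℂ) (y (b' - s))).im := rfl
        rw [neg_mul, Complex.neg_im]
        linarith)
      (by simpa using hyb') (by simpa using himb')
      (fun s hs => hIim _ ⟨by linarith [hs.2], by linarith [hs.1]⟩)
      (by simpa using himb)
      (by rw [hrk, sub_zero, hderiv b' ⟨hlt.le, le_rfl⟩]; ring)
      (by rw [hrk, sub_sub_cancel, hderiv b ⟨le_rfl, hlt.le⟩]; ring)
      (by rw [Complex.div_ofReal_re, Complex.neg_re]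
          exact div_pos (h2.lt_of_ne (neg_ne_zero.2 hzre').symm) hr)
      (by rw [Complex.div_ofReal_re, Complex.neg_re]
          exact div_pos (h1.lt_of_ne (neg_ne_zero.2 hzre).symm) hr)
      hcne (by rw [hdivsq, neg_sq, sub_zero, hcb']) (by rw [hdivsq, neg_sq, sub_sub_cancel, hcb])
    rw [Complex.div_ofReal_im, Complex.div_ofReal_im, Complex.neg_im, Complex.neg_im,
      Complex.re_mul_ofReal] at key
    obtain ⟨k1, k2, k3⟩ := key
    have hprod : (z b).im * (z b').im < 0 := by
      have e : -(z b').im / r * (-(z b).im / r) = (z b).im * (z b').im / r ^ 2 := by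
        field_simp
      rw [e] at k1
      by_contra! hn
      exact absurd k1 (div_nonneg hn (by positivity)).not_gt
    refine ⟨hprod, fun hpos => ?_, fun hneg => ?_⟩
    · rw [show 2 * r * κ.re = 2 * (κ.re * r) by ring]
      exact k2 (div_pos (neg_pos.2 (neg_of_mul_neg_right hprod hpos.le)) hr)
    · rw [show 2 * r * κ.re = 2 * (κ.re * r) by ring, mul_comm r]
      exact k3 (div_neg_of_neg_of_pos (neg_neg_of_pos (pos_of_mul_neg_right hprod hneg.le)) hr)
  · have hWI : ∀ s ∈ Set.Ioo b b', 0 < W s :=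
      pos_of_ne_zero_on_Ioo hWcont.continuousOn hWne hm hWm
    obtain ⟨h1, h2⟩ := hzclosure Complex.re Complex.continuous_re
      (fun s hs => (hWsign s hs).1.1 (hWI s hs))
    have key := quarter_turn_duration (Y := fun s => y (b + s)) (V := fun s => deriv y (b + s))
      (k := κ * r) (z₀ := z b / r) (z₁ := z b' / r) (L := b' - b) (c := -lam / r ^ 2)
      hkre hkim hL
      (hext.continuous.comp (continuous_const.add continuous_id)).continuousOn
      (hext.continuous_deriv.comp (continuous_const.add continuous_id)).continuousOn
      (fun s _ => (hext.hasDerivAt (b + s)).comp_const_add b s)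
      (fun s hs => (hV' (b + s) ⟨by linarith [hs.1], by linarith [hs.2]⟩).comp_const_add b s)
      (fun s hs => by
        have hm' : W (b + s / 2) < W (b + s) := hWmono (by linarith [hs.1])
        exact (hWI (b + s / 2) ⟨by linarith [hs.1], by linarith [hs.1, hs.2]⟩).trans hm')
      (by simpa using hyb) (by simpa using himb)
      (fun s hs => hIim _ ⟨by linarith [hs.1], by linarith [hs.2]⟩)
      (by simpa using himb')
      (by rw [hrk, add_zero, hderiv b ⟨le_rfl, hlt.le⟩])
      (by rw [hrk, add_sub_cancel, hderiv b' ⟨hlt.le, le_rfl⟩])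
      (by rw [Complex.div_ofReal_re]; exact div_pos (h1.lt_of_ne hzre.symm) hr)
      (by rw [Complex.div_ofReal_re]; exact div_pos (h2.lt_of_ne hzre'.symm) hr)
      hcne (by rw [hdivsq, add_zero, hcb]) (by rw [hdivsq, add_sub_cancel, hcb'])
    rw [Complex.div_ofReal_im, Complex.div_ofReal_im, Complex.re_mul_ofReal] at key
    obtain ⟨k1, k2, k3⟩ := key
    have hprod : (z b).im * (z b').im < 0 := by
      have e : (z b).im / r * ((z b').im / r) = (z b).im * (z b').im / r ^ 2 := by
        field_simp
      rw [e] at k1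
      by_contra! hn
      exact absurd k1 (div_nonneg hn (by positivity)).not_gt
    refine ⟨hprod, fun hpos => ?_, fun hneg => ?_⟩
    · rw [show 2 * r * κ.re = 2 * (κ.re * r) by ring]
      exact k2 (div_pos hpos hr)
    · rw [show 2 * r * κ.re = 2 * (κ.re * r) by ring, mul_comm r]
      exact k3 (div_neg_of_neg_of_pos hneg hr)

end LayeredExtremal

theorem theorem5p8 (κ : ℂ) (hκre : 0 < κ.re) (hκim : κ.im < 0)
    (n₁ n₂ : ℝ) (hn₁ : 0 < n₁) (hn : n₁ < n₂)
    (x : ℝ → OnePoint ℂ) (ε : ℝ → ℝ) (lam : ℝ) (y : ℝ → ℂ)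
    (hext : LayeredExtremal.IsExtendedExtremal κ n₁ n₂ x ε lam y) (hnormal : 0 < lam)
    (b b' ϵ : ℝ) (hlayer : LayeredExtremal.IsLayer ε b b' ϵ)
    (hsec : ∀ s ∈ Set.Ioo b b',
      x s ∈ ((↑) : ℂ → OnePoint ℂ) '' LayeredExtremal.ordinaryRegion κ) :
    (x b ∈ LayeredExtremal.upperHalf →
      x b' ∈ LayeredExtremal.lowerHalf ∧
      b' - b < Real.pi / (2 * Real.sqrt ϵ * κ.re)) ∧
    (x b ∈ LayeredExtremal.lowerHalf →
      x b' ∈ LayeredExtremal.upperHalf ∧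
      Real.pi / (2 * Real.sqrt ϵ * κ.re) < b' - b ∧
      b' - b < Real.pi / (Real.sqrt ϵ * κ.re)) := by
  obtain ⟨-, hyb', hprod, hup, hdown⟩ := LayeredExtremal.layer_alternative hκre hκim hn₁ hn hext
    hnormal hlayer hsec
  refine ⟨fun hb => ?_, fun hb => ?_⟩
  · have him := (hext.of_state_mem_image hb).2
    refine ⟨?_, hup him⟩
    rw [hext.state_of_ne_zero hyb']
    exact ⟨_, neg_of_mul_neg_right hprod (le_of_lt him), rfl⟩
  · have him := (hext.of_state_mem_image hb).2
    refine ⟨?_, hdown him⟩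
    rw [hext.state_of_ne_zero hyb']
    exact ⟨_, pos_of_mul_neg_right hprod (le_of_lt him), rfl⟩
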